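/- All Banach spaces are real. For a Banach space $X$ and $\varepsilon>0$, define for every ordinal $\beta$ a subset $B^{(\beta)}_\varepsilon$ of the closed dual unit ball $B_{X^*}$ by transfinite recursion: $B^{(0)}_\varepsilon=B_{X^*}$; $B^{(\beta+1)}_\varepsilon$ is the set of all $\xi\in B^{(\beta)}_\varepsilon$ such that every $w^*$-open neighbourhood $U$ of $\xi$ satisfies $\|\cdot\|\text{-}\mathrm{diam}\big(U\cap B^{(\beta)}_\varepsilon\big)\ge\varepsilon$; and $B^{(\beta)}_\varepsilon=\bigcap_{\gamma<\beta}B^{(\gamma)}_\varepsilon$ for limit ordinals $\beta$. The $\varepsilon$-Szlenk index $\mathrm{Sz}(X,\varepsilon)$ is the least ordinal $\beta$ with $B^{(\beta)}_\varepsilon=\emptyset$, and $\infty$ (which is not an ordinal) if there is no such $\beta$. Let $D=\{0,1\}^{\mathbb N}$ be the Cantor set with the product topology. For a compact space $K$ let $C(K)$ be the space of continuous real-valued functions on $K$ with the supremum norm, and let $C[0,\alpha]=C(K)$ for $K$ the ordinal interval $[0,\alpha]$ with its order topology. **Corollary 5.2.** Let $X$ be a Banach space with separable dual. Then there is a linear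 isometric embedding of $X$ into $C(D)$. Moreover, for every linear isometric embedding $i\colon X\to C(D)$ and every $\varepsilon>0$, the index $\mathrm{Sz}(X,\varepsilon/2)$ is an ordinal, and there are a countable ordinal $\alpha<\omega^{\mathrm{Sz}(X,\varepsilon/2)+\omega}$ and a linear subspace $Y$ of $C(D)$, linearly isometric to $C[0,\alpha]$, such that for every $x\in X$ there is $y\in Y$ with $\|i(x)-y\|\le\varepsilon\|x\|$. -/

import Mathlib

open Set Ordinal TopologicalSpace
open scoped ENNReal

universe u

noncomputable section

/-- The diameter of `S` with respect to a (pseudo-metric) function `d`, as an extended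
non-negative real number. -/
def pdiam {T : Type u} (d : T → T → ℝ) (S : Set T) : ℝ≥0∞ :=
  ⨆ x ∈ S, ⨆ y ∈ S, ENNReal.ofReal (d x y)

/-- The `ε`-derivative of `F` with respect to `d`: the points of `F` all of whose open
neighbourhoods `U` satisfy `d-diam (U ∩ F) ≥ ε`. -/
def fragDeriv {T : Type u} [TopologicalSpace T] (d : T → T → ℝ) (ε : ℝ) (F : Set T) : Set T :=
  {ξ ∈ F | ∀ U : Set T, IsOpen U → ξ ∈ U → ENNReal.ofReal ε ≤ pdiam d (U ∩ F)}

/-- The `ε`-derivative of `F` of order `α`, by transfinite recursion: derive at successors,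
intersect at limits. -/
def fragIter {T : Type u} [TopologicalSpace T] (d : T → T → ℝ) (ε : ℝ) (F : Set T)
    (α : Ordinal.{u}) : Set T :=
  Ordinal.limitRecOn α F (fun _ S => fragDeriv d ε S)
    (fun β _ ih => ⋂ (γ : Ordinal.{u}) (h : γ < β), ih γ h)

open Classical in
/-- The `ε`-fragmentation index of `F` with respect to `d`: the least ordinal `β` such that
the `ε`-derivative of order `β` is empty, and `⊤` (for `∞`) if there is no such ordinal. -/
def fragIndex {T : Type u} [TopologicalSpace T] (d : T → T → ℝ) (F : Set T) (ε : ℝ) :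
    WithTop Ordinal.{u} :=
  if ∃ β : Ordinal.{u}, fragIter d ε F β = ∅ then
    ((sInf {β : Ordinal.{u} | fragIter d ε F β = ∅} : Ordinal.{u}) : WithTop Ordinal.{u})
  else ⊤

/-- The `ε`-Szlenk index `Sz(X, ε)` of a real normed space `X`: the `ε`-fragmentation index of
the closed unit ball of the dual, with the weak-star topology, with respect to the dual norm. -/
def szlenkIndex (X : Type u) [NormedAddCommGroup X] [NormedSpace ℝ X] (ε : ℝ) :
    WithTop Ordinal.{u} :=
  fragIndex
    (fun f g : WeakDual ℝ X => ‖WeakDual.toStrongDual f - WeakDual.toStrongDual g‖)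
    {f : WeakDual ℝ X | ‖WeakDual.toStrongDual f‖ ≤ 1} ε

/-- The Cantor set `{0,1}^ℕ`, with the product topology of the discrete topologies. -/
abbrev CantorSet : Type := ℕ → Bool

end

/-!
Write `d s t = ‖φ s - φ t‖` on the Cantor set `D`, where `φ : D → B_{X*}` sends `t` to the functional
`x ↦ i x t`. A continuous surjection `r` of `D` onto an ordinal interval `[0, α]` embeds `C[0, α]`
isometrically into `C(D)` by composition, and if the fibres of `r` have `d`-diameter at most `ε / 2`
then every `i x` oscillates by at most `(ε / 2) ‖x‖` on each fibre, so that a partition of unity on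
`[0, α]` produces a function of the form `g ∘ r` within `ε ‖x‖` of `i x`
(`exists_norm_sub_comp_le`). Everything is thus reduced to finding such an `r`
(`exists_hasOrdinalFibration`).

Let `S β` be the preimage under `φ` of the derived set of order `β` of the dual ball, for `ε / 2`.
By induction on `β`, every clopen `A ⊆ D` disjoint from `S β` maps, with `d`-small fibres, onto an
interval `[0, δ)` with `δ < ω ^ β` countable. Limit steps are compactness. For `β = γ + 1`,
compactness and the definition of the derivative reduce to the case where `A ∩ S γ` is itself
`d`-small. Then `A \ S γ` is a disjoint union of clopen sets `C n`, each of which maps onto an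
interval `[0, δ n)` with `δ n < ω ^ γ`; stack these intervals one after the other and send the
whole of `A ∩ S γ` to the supremum of their end points (`HasOrdinalFibration.of_iUnion`). The
result is at most `ω ^ γ + 1`, hence below `ω ^ (γ + 1)`. With `σ = Sz(X, ε / 2)` one has
`S σ = ∅`, so `A = D` is allowed, and in fact `α < ω ^ σ`.

That `σ` is an ordinal follows from Baire's theorem: as `X*` is separable, a nonempty weak-star
compact set has nonempty relatively open subsets of small norm diameter
(`fragDeriv_weakDual_ne`). The existence of an isometric embedding of `X` into `C(D)` is the
Banach-Mazur argument based on the Hausdorff-Alexandroff theorem.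
-/

/-! ### Continuous maps with small fibres onto ordinal intervals -/

section OrdinalFibration

open Filter Topology

theorem Ordinal.continuous_fixed_add (a : Ordinal.{u}) : Continuous fun b => a + b :=
  (isNormal_add_right a).continuous

theorem Ordinal.exists_eq_add_of_le_of_lt {a b e : Ordinal.{u}} (h₁ : a ≤ b) (h₂ : b < a + e) :
    ∃ x < e, b = a + x :=
  ⟨b - a, by rwa [← _root_.add_lt_add_iff_left a, Ordinal.add_sub_cancel_of_le h₁],
    (Ordinal.add_sub_cancel_of_le h₁).symm⟩

/-- `HasOrdinalFibration d c A δ` says that `A` admits a continuous map onto the ordinal interval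
`[0, δ)` all of whose fibres have `d`-diameter at most `c`. -/
def HasOrdinalFibration {T : Type*} [TopologicalSpace T] (d : T → T → ℝ) (c : ℝ) (A : Set T)
    (δ : Ordinal.{u}) : Prop :=
  ∃ r : T → Ordinal.{u}, ContinuousOn r A ∧ r '' A = Iio δ ∧
    ∀ x ∈ A, ∀ y ∈ A, r x = r y → d x y ≤ c

namespace HasOrdinalFibration

variable {T : Type*} [TopologicalSpace T] {d : T → T → ℝ} {c : ℝ}

theorem empty : HasOrdinalFibration.{u} d c ∅ 0 :=
  ⟨fun _ => 0, continuousOn_empty _, by simp, by simp⟩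

theorem union {A B : Set T} {δ η : Ordinal.{u}} (hA : IsClopen A) (hB : IsClopen B)
    (hAB : Disjoint A B) (h₁ : HasOrdinalFibration d c A δ) (h₂ : HasOrdinalFibration d c B η) :
    HasOrdinalFibration d c (A ∪ B) (δ + η) := by
  classical
  obtain ⟨r, hr, hri, hrd⟩ := h₁
  obtain ⟨q, hq, hqi, hqd⟩ := h₂
  set p : T → Ordinal.{u} := fun t => if t ∈ A then r t else δ + q t with hp
  have hpA : ∀ t ∈ A, p t = r t := fun t ht => if_pos ht
  have hpB : ∀ t ∈ B, p t = δ + q t := fun t ht => if_neg fun h => hAB.le_bot ⟨h, ht⟩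
  have hrA : ∀ t ∈ A, r t < δ := fun t ht => hri.subset (mem_image_of_mem r ht)
  have hqB : ∀ t ∈ B, q t < η := fun t ht => hqi.subset (mem_image_of_mem q ht)
  refine ⟨p, ?_, ?_, ?_⟩
  · refine ContinuousOn.union_of_isOpen (hr.congr hpA) ?_ hA.isOpen hB.isOpen
    exact ((continuous_fixed_add δ).comp_continuousOn hq).congr hpB
  · ext a
    constructor
    · rintro ⟨t, ht | ht, rfl⟩
      · exact (hpA t ht).trans_lt ((hrA t ht).trans_le le_self_add)
      · rw [hpB t ht, mem_Iio]
        exact (_root_.add_lt_add_iff_left δ).2 (hqB t ht)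
    · intro ha
      rcases lt_or_ge a δ with h | h
      · obtain ⟨t, ht, rfl⟩ := hri.superset h
        exact ⟨t, Or.inl ht, hpA t ht⟩
      · obtain ⟨x, hx, rfl⟩ := exists_eq_add_of_le_of_lt h ha
        obtain ⟨t, ht, rfl⟩ := hqi.superset hx
        exact ⟨t, Or.inr ht, hpB t ht⟩
  · rintro x (hx | hx) y (hy | hy) h
    · rw [hpA x hx, hpA y hy] at h
      exact hrd x hx y hy h
    · rw [hpA x hx, hpB y hy] at h
      exact absurd (h ▸ hrA x hx) (not_lt.2 le_self_add)
    · rw [hpB x hx, hpA y hy] at h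
      exact absurd (h.symm ▸ hrA y hy) (not_lt.2 le_self_add)
    · rw [hpB x hx, hpB y hy] at h
      exact hqd x hx y hy (add_left_cancel h)

/-- The fibration behind the successor step: the intervals belonging to the clopen pieces `C n` are
stacked one after the other, and the remainder `F` is sent to the supremum `s` of their end points.
Continuity at points of `F` holds because only finitely many pieces lie below any ordinal `< s`,
and these are closed. -/
theorem of_iUnion {A F : Set T} {C : ℕ → Set T} {δ : ℕ → Ordinal.{u}} {o : Ordinal.{u}}
    (ho : IsPrincipal (· + ·) o) (ho₀ : 0 < o) (hδo : ∀ n, δ n < o)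
    (hδc : ∀ n, (Iio (δ n)).Countable)
    (hC : ∀ n, IsClopen (C n)) (hCd : Pairwise fun m n => Disjoint (C m) (C n))
    (hFC : ∀ n, Disjoint F (C n)) (hA : A = F ∪ ⋃ n, C n)
    (hFd : ∀ x ∈ F, ∀ y ∈ F, d x y ≤ c)
    (h : ∀ n, HasOrdinalFibration d c (C n) (δ n)) :
    ∃ e ≤ o + 1, (Iio e).Countable ∧ HasOrdinalFibration d c A e := by
  classical
  choose r hr hri hrd using h
  set s : ℕ → Ordinal.{u} := fun n => Nat.rec 0 (fun n x => x + δ n) n with hs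
  have hsucc : ∀ n, s (n + 1) = s n + δ n := fun n => rfl
  have hsm : Monotone s := monotone_nat_of_le_succ fun n => le_self_add
  have hso : ∀ n, s n < o := by
    intro n
    induction n with
    | zero => exact ho₀
    | succ n ih => exact ho ih (hδo n)
  set S : Ordinal.{u} := ⨆ n, s n with hS
  have hle : ∀ n, s n ≤ S := Ordinal.le_iSup s
  have hSo : S ≤ o := Ordinal.iSup_le fun n => (hso n).le
  set p : T → Ordinal.{u} := fun t => if h : ∃ n, t ∈ C n then s h.choose + r h.choose t else S
    with hp
  have hpC : ∀ n, ∀ t ∈ C n, p t = s n + r n t := by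
    intro n t ht
    have hex : ∃ n, t ∈ C n := ⟨n, ht⟩
    have hn : hex.choose = n := by
      by_contra hne
      exact (hCd hne).le_bot ⟨hex.choose_spec, ht⟩
    simp only [hp]
    rw [dif_pos hex, hn]
  have hpF : ∀ t ∈ F, p t = S := fun t ht =>
    dif_neg fun ⟨n, hn⟩ => (hFC n).le_bot ⟨ht, hn⟩
  have hrC : ∀ n, ∀ t ∈ C n, r n t < δ n := fun n t ht => (hri n).subset (mem_image_of_mem _ ht)
  have hplt : ∀ n, ∀ t ∈ C n, p t < s (n + 1) := by
    intro n t ht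
    rw [hpC n t ht, hsucc]
    exact (_root_.add_lt_add_iff_left _).2 (hrC n t ht)
  have hpge : ∀ n, ∀ t ∈ C n, s n ≤ p t := fun n t ht => by
    rw [hpC n t ht]; exact le_self_add
  have hpS : ∀ t, p t ≤ S := by
    intro t
    by_cases ht : ∃ n, t ∈ C n
    · obtain ⟨n, hn⟩ := ht
      exact (hplt n t hn).le.trans (hle (n + 1))
    · exact (dif_neg ht).le
  have hpcont : ContinuousOn p A := by
    intro t ht
    rw [hA] at ht
    rcases ht with ht | ht
    · refine tendsto_order.2 ⟨fun a ha => ?_, fun b hb => ?_⟩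
      · rw [hpF t ht] at ha
        obtain ⟨n, hn⟩ := Ordinal.lt_iSup_iff.1 ha
        have hO : IsOpen (⋃ k ∈ Finset.range n, C k)ᶜ :=
          (isClosed_biUnion_finset fun k _ => (hC k).isClosed).isOpen_compl
        have htO : t ∈ (⋃ k ∈ Finset.range n, C k)ᶜ := by
          simp only [mem_compl_iff, mem_iUnion, not_exists]
          exact fun k _ hk => (hFC k).le_bot ⟨ht, hk⟩
        filter_upwards [mem_nhdsWithin_of_mem_nhds (hO.mem_nhds htO), self_mem_nhdsWithin]
          with t' ht' htA
        rw [hA] at htA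
        rcases htA with htF | htC
        · rwa [hpF t' htF]
        · obtain ⟨m, hm⟩ := mem_iUnion.1 htC
          have hnm : n ≤ m := by
            by_contra! hlt
            exact ht' (mem_biUnion (Finset.mem_range.2 hlt) hm)
          exact hn.trans_le ((hsm hnm).trans (hpge m t' hm))
      · rw [hpF t ht] at hb
        exact Eventually.of_forall fun t' => (hpS t').trans_lt hb
    · obtain ⟨n, hn⟩ := mem_iUnion.1 ht
      have hc : ContinuousOn p (C n) :=
        ((continuous_fixed_add (s n)).comp_continuousOn (hr n)).congr (hpC n)
      exact (hc.continuousAt ((hC n).isOpen.mem_nhds hn)).continuousWithinAt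
  have himC : p '' (⋃ n, C n) = Iio S := by
    ext a
    constructor
    · rintro ⟨t, ht, rfl⟩
      obtain ⟨n, hn⟩ := mem_iUnion.1 ht
      exact (hplt n t hn).trans_le (hle (n + 1))
    · intro ha
      have hex : ∃ n, a < s n := (Ordinal.lt_iSup_iff).1 ha
      obtain ⟨m, hm, hm'⟩ : ∃ m, s m ≤ a ∧ a < s (m + 1) := by
        have hspec := Nat.find_spec hex
        cases hk : Nat.find hex with
        | zero => rw [hk] at hspec; exact absurd hspec not_lt_zero
        | succ m =>
          rw [hk] at hspec
          exact ⟨m, not_lt.1 (Nat.find_min hex (by omega)), hspec⟩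
      obtain ⟨x, hx, rfl⟩ := exists_eq_add_of_le_of_lt hm hm'
      obtain ⟨t, ht, rfl⟩ := (hri m).superset hx
      exact ⟨t, mem_iUnion.2 ⟨m, ht⟩, hpC m t ht⟩
  have hScount : (Iio S).Countable := by
    rw [← himC, image_iUnion]
    refine countable_iUnion fun n => ?_
    have : p '' C n ⊆ (fun x => s n + x) '' Iio (δ n) := by
      rintro _ ⟨t, ht, rfl⟩
      exact ⟨r n t, hrC n t ht, (hpC n t ht).symm⟩
    exact ((hδc n).image _).mono this
  have hdist : ∀ x ∈ A, ∀ y ∈ A, p x = p y → d x y ≤ c := by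
    have key : ∀ m n, ∀ x ∈ C m, ∀ y ∈ C n, p x = p y → m ≤ n := by
      intro m n x hx y hy hxy
      by_contra! hlt
      have h1 := (hplt n y hy).trans_le ((hsm hlt).trans (hpge m x hx))
      exact h1.ne hxy.symm
    have hne : ∀ n, ∀ x ∈ C n, p x ≠ S := fun n x hx => ((hplt n x hx).trans_le (hle (n + 1))).ne
    intro x hx y hy hxy
    rw [hA] at hx hy
    rcases hx with hx | hx <;> rcases hy with hy | hy
    · exact hFd x hx y hy
    · obtain ⟨n, hn⟩ := mem_iUnion.1 hy
      exact absurd (hxy.symm.trans (hpF x hx)) (hne n y hn)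
    · obtain ⟨n, hn⟩ := mem_iUnion.1 hx
      exact absurd (hxy.trans (hpF y hy)) (hne n x hn)
    · obtain ⟨m, hm⟩ := mem_iUnion.1 hx
      obtain ⟨n, hn⟩ := mem_iUnion.1 hy
      obtain rfl := le_antisymm (key m n x hm y hn hxy) (key n m y hn x hm hxy.symm)
      rw [hpC m x hm, hpC m y hn] at hxy
      exact hrd m x hm y hn (add_left_cancel hxy)
  rcases F.eq_empty_or_nonempty with rfl | hF
  · refine ⟨S, hSo.trans le_self_add, hScount, p, hpcont, ?_, hdist⟩
    rw [hA, empty_union, himC]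
  · have hI : Iio (S + 1) = insert S (Iio S) := by
      ext a; simp [Order.lt_add_one_iff, le_iff_eq_or_lt]
    refine ⟨S + 1, by gcongr, hI ▸ hScount.insert S, p, hpcont, ?_, hdist⟩
    rw [hA, image_union, himC, hI, ← singleton_union]
    congr 1
    exact Subset.antisymm (by rintro _ ⟨t, ht, rfl⟩; exact hpF t ht)
      (by rintro _ rfl; obtain ⟨t, ht⟩ := hF; exact ⟨t, ht, hpF t ht⟩)

end HasOrdinalFibration

/-- A clopen set avoiding the `β`-th term of a suitable decreasing transfinite sequence `S` of closed
sets fibres over a countable ordinal less than `ω ^ β`. The hypothesis `hstep` says that `S γ` is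
locally `d`-small off `S (γ + 1)`. -/
theorem exists_hasOrdinalFibration {T : Type*} [TopologicalSpace T] [CompactSpace T] [T2Space T]
    [TotallyDisconnectedSpace T] [SecondCountableTopology T] {d : T → T → ℝ} {c : ℝ}
    {S : Ordinal.{u} → Set T} (hcl : ∀ β, IsClosed (S β)) (hanti : Antitone S) (h0 : S 0 = Set.univ)
    (hlim : ∀ β, Order.IsSuccLimit β → S β = ⋂ γ : Iio β, S γ)
    (hstep : ∀ γ, ∀ t ∉ S (γ + 1), ∃ U, IsOpen U ∧ t ∈ U ∧
      ∀ x ∈ U ∩ S γ, ∀ y ∈ U ∩ S γ, d x y ≤ c) (β : Ordinal.{u}) :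
    ∀ A : Set T, IsClopen A → A ∩ S β = ∅ →
      ∃ δ < ω ^ β, (Iio δ).Countable ∧ HasOrdinalFibration d c A δ := by
  induction β using Ordinal.limitRecOn with
  | zero =>
    intro A _ hA
    rw [h0, inter_univ] at hA
    subst hA
    exact ⟨0, by simp, by simp, .empty⟩
  | add_one γ ih =>
    have hlt : (ω : Ordinal.{u}) ^ γ + 1 < ω ^ (γ + 1) := by
      have h1 : (ω : Ordinal.{u}) ^ γ < ω ^ (γ + 1) :=
        (opow_lt_opow_iff_right one_lt_omega0).2 (lt_add_one γ)
      exact isPrincipal_add_omega0_opow (γ + 1) h1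
        ((one_lt_omega0).trans_le (left_le_opow _ (by simp)))
    -- A clopen set meeting `S γ` in a `d`-small set: exhaust the rest by disjoint clopen sets.
    have hsmall : ∀ B : Set T, IsClopen B → (∀ x ∈ B ∩ S γ, ∀ y ∈ B ∩ S γ, d x y ≤ c) →
        ∃ δ < ω ^ (γ + 1), (Iio δ).Countable ∧ HasOrdinalFibration d c B δ := by
      intro B hB hBd
      obtain ⟨V, hV, hVB⟩ : ∃ V : ℕ → Set T, (∀ n, IsClopen (V n)) ∧ ⋃ n, V n = B \ S γ := by
        have hO : IsOpen (B \ S γ) := hB.isOpen.sdiff (hcl γ)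
        choose W hW hxW hWO using fun x : (B \ S γ : Set T) =>
          compact_exists_isClopen_in_isOpen hO x.2
        obtain ⟨Q, hQ, hQU⟩ := isOpen_iUnion_countable W fun x => (hW x).isOpen
        obtain ⟨V, hV⟩ := ((hQ.image W).insert ∅).exists_eq_range (insert_nonempty _ _)
        refine ⟨V, fun n => ?_, ?_⟩
        · have : V n ∈ insert ∅ (W '' Q) := hV ▸ mem_range_self n
          rcases this with h | ⟨x, -, h⟩
          · exact h ▸ isClopen_empty
          · exact h ▸ hW x
        · rw [← sUnion_range, ← hV, sUnion_insert, empty_union, sUnion_image, hQU]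
          exact Subset.antisymm (iUnion_subset hWO) fun x hx => mem_iUnion.2 ⟨⟨x, hx⟩, hxW ⟨x, hx⟩⟩
      have hD : ∀ n, IsClopen (disjointed V n) := by
        intro n
        exact disjointedRec (fun _ i h => h.diff (hV i)) (hV n)
      have hDU : ⋃ n, disjointed V n = B \ S γ := by rw [iUnion_disjointed, hVB]
      have hDB : ∀ n, disjointed V n ⊆ B \ S γ := fun n => hDU ▸ subset_iUnion _ n
      choose δ hδ hδc hδf using fun n => ih (disjointed V n) (hD n) (by
        rw [← disjoint_iff_inter_eq_empty]
        exact disjoint_sdiff_left.mono_left (hDB n))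
      obtain ⟨e, he, hec, hef⟩ := HasOrdinalFibration.of_iUnion (A := B) (F := B ∩ S γ)
        (isPrincipal_add_omega0_opow γ) (opow_pos γ omega0_pos) hδ hδc hD
        (disjoint_disjointed V)
        (fun n => (disjoint_sdiff_left.mono_left (hDB n)).symm.mono_left inter_subset_right)
        (by rw [hDU, inter_union_sdiff]) hBd hδf
      exact ⟨e, he.trans_lt hlt, hec, hef⟩
    intro A hA hAS
    -- Compactness: finitely many such sets cover `A`.
    obtain ⟨C, hC, hAC, hCf⟩ : ∃ C : Set T, IsClopen C ∧ A ⊆ C ∧ ∀ B ⊆ C, IsClopen B →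
        ∃ δ < ω ^ (γ + 1), (Iio δ).Countable ∧ HasOrdinalFibration d c B δ := by
      refine hA.isClosed.isCompact.induction_on
        (p := fun Q => ∃ C : Set T, IsClopen C ∧ Q ⊆ C ∧ ∀ B ⊆ C, IsClopen B →
          ∃ δ < ω ^ (γ + 1), (Iio δ).Countable ∧ HasOrdinalFibration d c B δ) ?_ ?_ ?_ ?_
      · refine ⟨∅, isClopen_empty, Subset.rfl, fun B hB _ => ?_⟩
        obtain rfl := subset_empty_iff.1 hB
        exact ⟨0, opow_pos _ omega0_pos, by simp, .empty⟩
      · rintro Q R hQR ⟨C, hC, hRC, h⟩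
        exact ⟨C, hC, hQR.trans hRC, h⟩
      · rintro Q R ⟨C, hC, hQC, h⟩ ⟨D, hD, hRD, h'⟩
        refine ⟨C ∪ D, hC.union hD, union_subset_union hQC hRD, fun B hB hBc => ?_⟩
        obtain ⟨δ, hδ, hδc, hδf⟩ := h (B ∩ C) inter_subset_right (hBc.inter hC)
        obtain ⟨η, hη, hηc, hηf⟩ := h' (B \ C) (by grind) (hBc.diff hC)
        refine ⟨δ + η, isPrincipal_add_omega0_opow _ hδ hη, ?_, ?_⟩
        · have : Iio (δ + η) ⊆ Iio δ ∪ (fun x => δ + x) '' Iio η := by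
            intro a ha
            rcases lt_or_ge a δ with h | h
            · exact Or.inl h
            · obtain ⟨x, hx, rfl⟩ := exists_eq_add_of_le_of_lt h ha
              exact Or.inr ⟨x, hx, rfl⟩
          exact (hδc.union (hηc.image _)).mono this
        · have := hδf.union (hBc.inter hC) (hBc.diff hC)
            (disjoint_sdiff_right.mono_left inter_subset_right) hηf
          rwa [inter_union_sdiff] at this
      · intro t ht
        obtain ⟨U, hU, htU, hUd⟩ := hstep γ t fun h => (hAS ▸ mem_inter ht h : t ∈ (∅ : Set T))
        obtain ⟨W, hW, htW, hWU⟩ := compact_exists_isClopen_in_isOpen hU htU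
        refine ⟨W, mem_nhdsWithin_of_mem_nhds (hW.isOpen.mem_nhds htW), W, hW, Subset.rfl,
          fun B hB hBc => hsmall B hBc fun x hx y hy => hUd x ?_ y ?_⟩
        · exact ⟨hWU (hB hx.1), hx.2⟩
        · exact ⟨hWU (hB hy.1), hy.2⟩
    exact hCf A hAC hA
  | limit β hβ ih =>
    intro A hA hAS
    have : Nonempty (Iio β) := ⟨⟨0, hβ.bot_lt⟩⟩
    obtain ⟨⟨γ, hγ⟩, h⟩ := hA.isClosed.isCompact.elim_directed_family_closed
      (fun γ : Iio β => S γ) (fun γ => hcl γ) (by rw [← hlim β hβ, hAS])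
      (directed_of_isDirected_le fun a b hab => hanti hab)
    obtain ⟨δ, hδ, h'⟩ := ih γ hγ A hA h
    exact ⟨δ, hδ.trans ((opow_lt_opow_iff_right one_lt_omega0).2 hγ), h'⟩

end OrdinalFibration

/-! ### Iterated derivatives -/

section Fragmentation

variable {T : Type u} {d : T → T → ℝ} {ε : ℝ} {F : Set T}

theorem dist_le_of_pdiam_lt {S : Set T} (hε : 0 ≤ ε) (h : pdiam d S < ENNReal.ofReal ε) {x y : T}
    (hx : x ∈ S) (hy : y ∈ S) : d x y ≤ ε := by
  have : ENNReal.ofReal (d x y) ≤ pdiam d S :=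
    le_iSup₂_of_le x hx (le_iSup₂_of_le y hy le_rfl)
  exact (ENNReal.ofReal_le_ofReal_iff hε).1 (this.trans h.le)

theorem pdiam_le {S : Set T} {c : ℝ} (h : ∀ x ∈ S, ∀ y ∈ S, d x y ≤ c) :
    pdiam d S ≤ ENNReal.ofReal c :=
  iSup₂_le fun x hx => iSup₂_le fun y hy => ENNReal.ofReal_le_ofReal (h x hx y hy)

variable [TopologicalSpace T]

theorem isClosed_fragDeriv (hF : IsClosed F) : IsClosed (fragDeriv d ε F) := by
  have : fragDeriv d ε F = F ∩ ⋂ U ∈ {U : Set T | IsOpen U ∧ pdiam d (U ∩ F) < ENNReal.ofReal ε},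
      Uᶜ := by
    ext t
    simp only [fragDeriv, mem_ofPred_eq, mem_inter_iff, mem_iInter, mem_compl_iff]
    refine and_congr_right fun _ => forall_congr' fun U => ?_
    rw [← not_lt]
    tauto
  rw [this]
  exact hF.inter (isClosed_biInter fun U hU => hU.1.isClosed_compl)

theorem fragIter_zero : fragIter d ε F 0 = F := by simp [fragIter]

theorem fragIter_add_one (β : Ordinal.{u}) :
    fragIter d ε F (β + 1) = fragDeriv d ε (fragIter d ε F β) := by simp [fragIter]

theorem fragIter_limit {β : Ordinal.{u}} (hβ : Order.IsSuccLimit β) :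
    fragIter d ε F β = ⋂ γ : Iio β, fragIter d ε F γ := by
  rw [iInter_subtype]
  simp only [fragIter]
  rw [Ordinal.limitRecOn_limit _ _ _ _ hβ]
  rfl

theorem isClosed_fragIter (hF : IsClosed F) (β : Ordinal.{u}) : IsClosed (fragIter d ε F β) := by
  induction β using Ordinal.limitRecOn with
  | zero => rwa [fragIter_zero]
  | add_one β ih => rw [fragIter_add_one]; exact isClosed_fragDeriv ih
  | limit β hβ ih => rw [fragIter_limit hβ]; exact isClosed_iInter fun γ => ih γ γ.2

theorem fragIter_antitone : Antitone (fragIter d ε F) := by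
  intro γ β h
  induction β using Ordinal.limitRecOn with
  | zero => rw [nonpos_iff_eq_zero.1 h]
  | add_one β ih =>
    rcases h.eq_or_lt with rfl | h
    · exact le_rfl
    · rw [fragIter_add_one]
      exact (sep_subset _ _).trans (ih (Order.lt_add_one_iff.1 h))
  | limit β hβ ih =>
    rcases h.eq_or_lt with rfl | h
    · exact le_rfl
    · rw [fragIter_limit hβ]
      exact iInter_subset (fun γ : Iio β => fragIter d ε F γ) ⟨γ, h⟩

/-- If the derivative strictly shrinks nonempty closed sets, the iteration reaches `∅`: otherwise it
would embed the class of all ordinals into the powerset of `T`. -/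
theorem exists_fragIter_eq_empty (hF : IsClosed F)
    (h : ∀ G ⊆ F, IsClosed G → G.Nonempty → fragDeriv d ε G ≠ G) :
    ∃ β : Ordinal.{u}, fragIter d ε F β = ∅ := by
  by_contra! hne
  have hlt : ∀ γ β : Ordinal.{u}, γ < β → fragIter d ε F γ ≠ fragIter d ε F β := by
    intro γ β hγβ heq
    refine h (fragIter d ε F γ) ?_ (isClosed_fragIter hF γ) (hne γ) ?_
    · exact (fragIter_antitone zero_le).trans fragIter_zero.subset
    · rw [← fragIter_add_one]
      refine (fragIter_antitone le_self_add).antisymm ?_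
      rw [heq]
      exact fragIter_antitone (Order.add_one_le_of_lt hγβ)
  refine not_injective_of_ordinal (fragIter d ε F) fun γ β heq => ?_
  rcases lt_trichotomy γ β with hl | he | hl
  · exact absurd heq (hlt _ _ hl)
  · exact he
  · exact absurd heq.symm (hlt _ _ hl)

end Fragmentation

/-! ### The Szlenk index of a space with separable dual -/

section Szlenk

variable {X : Type u} [NormedAddCommGroup X] [NormedSpace ℝ X]

theorem isClosed_weakDual_closedBall (r : ℝ) :
    IsClosed {f : WeakDual ℝ X | ‖WeakDual.toStrongDual f‖ ≤ r} := by
  simpa [preimage, Metric.closedBall] using WeakDual.isClosed_closedBall (𝕜 := ℝ) (E := X) 0 r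

theorem isCompact_weakDual_closedBall (r : ℝ) :
    IsCompact {f : WeakDual ℝ X | ‖WeakDual.toStrongDual f‖ ≤ r} := by
  simpa [preimage, Metric.closedBall] using WeakDual.isCompact_closedBall (𝕜 := ℝ) (E := X) 0 r

/-- Cover a weak-star compact set by countably many norm balls of radius `ε / 3`; these are
weak-star closed, so by Baire's theorem one of them contains a relatively open part of the set. -/
theorem fragDeriv_weakDual_ne [SeparableSpace (StrongDual ℝ X)] {ε : ℝ} (hε : 0 < ε)
    {G : Set (WeakDual ℝ X)} (hG : IsCompact G) (hne : G.Nonempty) :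
    fragDeriv (fun f g : WeakDual ℝ X => ‖WeakDual.toStrongDual f - WeakDual.toStrongDual g‖) ε G
      ≠ G := by
  have : CompactSpace G := isCompact_iff_compactSpace.1 hG
  have : Nonempty G := hne.to_subtype
  let V : ℕ → Set G := fun n =>
    {f : G | WeakDual.toStrongDual (f : WeakDual ℝ X) ∈
      Metric.closedBall (denseSeq (StrongDual ℝ X) n) (ε / 3)}
  obtain ⟨n, f, hf⟩ := nonempty_interior_of_iUnion_of_closed (f := V)
    (fun n => (WeakDual.isClosed_closedBall _ _).preimage continuous_subtype_val) (by
      refine eq_univ_of_forall fun f => ?_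
      obtain ⟨n, hn⟩ := (denseRange_denseSeq (StrongDual ℝ X)).exists_dist_lt
        (WeakDual.toStrongDual (f : WeakDual ℝ X)) (by positivity : 0 < ε / 3)
      exact mem_iUnion.2 ⟨n, hn.le⟩)
  obtain ⟨W, hWV, hW, hfW⟩ := mem_interior.1 hf
  obtain ⟨U, hU, rfl⟩ := isOpen_induced_iff.1 hW
  intro heq
  have hfG : (f : WeakDual ℝ X) ∈ fragDeriv _ ε G := heq.symm.subset f.2
  refine (hfG.2 U hU hfW).not_gt (lt_of_le_of_lt (pdiam_le (c := 2 * (ε / 3)) ?_) ?_)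
  · rintro g ⟨hgU, hgG⟩ h ⟨hhU, hhG⟩
    have h1 : dist _ _ ≤ _ := hWV (a := ⟨g, hgG⟩) hgU
    have h2 : dist _ _ ≤ _ := hWV (a := ⟨h, hhG⟩) hhU
    have h3 := dist_triangle_right (WeakDual.toStrongDual g) (WeakDual.toStrongDual h)
      (denseSeq (StrongDual ℝ X) n)
    rw [dist_eq_norm (WeakDual.toStrongDual g) (WeakDual.toStrongDual h)] at h3
    simp only at h1 h2
    linarith
  · exact (ENNReal.ofReal_lt_ofReal_iff hε).2 (by linarith)

theorem exists_szlenkIndex_eq [SeparableSpace (StrongDual ℝ X)] {ε : ℝ} (hε : 0 < ε) :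
    ∃ σ : Ordinal.{u}, szlenkIndex X ε = (σ : WithTop Ordinal.{u}) ∧
      fragIter (fun f g : WeakDual ℝ X => ‖WeakDual.toStrongDual f - WeakDual.toStrongDual g‖) ε
        {f : WeakDual ℝ X | ‖WeakDual.toStrongDual f‖ ≤ 1} σ = ∅ := by
  have hex := exists_fragIter_eq_empty (isClosed_weakDual_closedBall (X := X) 1)
    fun G hGF hG hne =>
      fragDeriv_weakDual_ne hε ((isCompact_weakDual_closedBall 1).of_isClosed_subset hG hGF) hne
  refine ⟨_, if_pos hex, csInf_mem hex⟩

end Szlenk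

/-! ### Embedding into the continuous functions on the Cantor set -/

/-- For each member of a dense sequence of functionals choose a vector of the unit ball at which it
takes at least half its norm: by the Hahn-Banach theorem these vectors span a dense subspace. -/
theorem separableSpace_of_separableSpace_strongDual (X : Type*) [NormedAddCommGroup X]
    [NormedSpace ℝ X] [SeparableSpace (StrongDual ℝ X)] : SeparableSpace X := by
  have hx : ∀ f : StrongDual ℝ X, ∃ x : X, ‖x‖ ≤ 1 ∧ ‖f‖ / 2 ≤ f x := by
    intro f
    by_contra! h
    have hb : ‖f‖ ≤ ‖f‖ / 2 := by
      refine f.opNorm_le_of_unit_norm (by positivity) fun x hx => ?_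
      rw [Real.norm_eq_abs, abs_le]
      have h1 := h x hx.le
      have h2 := h (-x) (by rw [norm_neg, hx])
      rw [map_neg] at h2
      constructor <;> linarith
    have h0 := h 0 (by simp)
    rw [map_zero] at h0
    linarith
  choose v hv hfv using hx
  let g := denseSeq (StrongDual ℝ X)
  let S : Submodule ℝ X := (Submodule.span ℝ (range fun n => v (g n))).topologicalClosure
  have hS : S = ⊤ := by
    by_contra hne
    obtain ⟨x, hxS⟩ : ∃ x, x ∉ S := by
      by_contra! h
      exact hne (eq_top_iff.2 fun x _ => h x)
    obtain ⟨f, a, hfa, hax⟩ := geometric_hahn_banach_closed_point S.convex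
      (Submodule.isClosed_topologicalClosure _) hxS
    -- A functional bounded above on a subspace vanishes there.
    have hf0 : ∀ y ∈ S, f y = 0 := by
      intro y hy
      by_contra hy0
      have := hfa ((a / f y) • y) (S.smul_mem _ hy)
      rw [map_smul, _root_.smul_eq_mul, div_mul_cancel₀ _ hy0] at this
      exact this.false
    have ha : 0 < a := by simpa using hfa 0 S.zero_mem
    have hfn : 0 < ‖f‖ := norm_pos_iff.2 fun h => by
      rw [h] at hax
      simp at hax
      linarith
    obtain ⟨n, hn⟩ := (denseRange_denseSeq (StrongDual ℝ X)).exists_dist_lt f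
      (by positivity : 0 < ‖f‖ / 4)
    rw [dist_eq_norm] at hn
    have h1 : f (v (g n)) = 0 :=
      hf0 _ (Submodule.le_topologicalClosure _ (Submodule.subset_span (mem_range_self n)))
    have h2 := hfv (g n)
    have h3 : ‖(f - g n) (v (g n))‖ ≤ ‖f - g n‖ * 1 :=
      (f - g n).le_opNorm_of_le (hv _)
    have h4 := (abs_le.1 (Real.norm_eq_abs _ ▸ h3)).1
    rw [sub_apply, h1] at h4
    have h5 : ‖f‖ ≤ ‖g n‖ + ‖f - g n‖ := by
      simpa using norm_add_le (g n) (f - g n)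
    have hn' : ‖f - g n‖ < ‖f‖ / 4 := hn
    linarith
  have hsep : IsSeparable (S : Set X) := by
    rw [Submodule.topologicalClosure_coe]
    exact ((countable_range _).isSeparable.span (R := ℝ)).closure
  rw [hS, Submodule.top_coe] at hsep
  exact isSeparable_univ_iff.1 hsep

/-- The dual unit ball is weak-star compact and metrizable, hence a continuous image of the Cantor
set; evaluation along such a surjection is isometric by the Hahn-Banach theorem. -/
theorem nonempty_linearIsometry_cantorSet (X : Type u) [NormedAddCommGroup X] [NormedSpace ℝ X]
    [SeparableSpace X] : Nonempty (X →ₗᵢ[ℝ] C(CantorSet, ℝ)) := by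
  let B := {f : WeakDual ℝ X | ‖WeakDual.toStrongDual f‖ ≤ 1}
  have hB : IsCompact B := isCompact_weakDual_closedBall 1
  have : CompactSpace B := isCompact_iff_compactSpace.1 hB
  have := WeakDual.metrizable_of_isCompact ℝ X B hB
  let := metrizableSpaceMetric B
  have : Nonempty B := ⟨⟨0, by simp [B]⟩⟩
  obtain ⟨φ, hφ, hsurj⟩ := exists_nat_bool_continuous_surjective_of_compact B
  let ev : X →ₗ[ℝ] C(CantorSet, ℝ) :=
    { toFun := fun x => ⟨fun t => (φ t : WeakDual ℝ X) x,
        (WeakDual.eval_continuous x).comp (continuous_subtype_val.comp hφ)⟩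
      map_add' := fun x y => by ext t; simp
      map_smul' := fun a x => by ext t; simp }
  refine ⟨⟨ev, fun x => le_antisymm ?_ ?_⟩⟩
  · refine (ContinuousMap.norm_le _ (norm_nonneg x)).2 fun t => ?_
    have := (WeakDual.toStrongDual (φ t : WeakDual ℝ X)).le_of_opNorm_le (φ t).2 x
    rwa [one_mul] at this
  · obtain ⟨f, hf, hfx⟩ := exists_dual_vector'' ℝ x
    obtain ⟨t, ht⟩ := hsurj ⟨StrongDual.toWeakDual f, hf⟩
    have h1 : ev x t = ‖x‖ := by
      change (φ t : WeakDual ℝ X) x = ‖x‖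
      rw [ht]
      exact hfx
    rw [← h1]
    exact (le_abs_self _).trans ((ev x).norm_coe_le_norm t)

/-! ### Approximation by functions constant on fibres -/

open Filter Topology in
/-- If `f` oscillates by less than `η` on each fibre of the continuous surjection `r` of compact
spaces, then `f` lies within `η` of a function factoring through `r`: near each point `k` the value
of `f` at a point of the fibre over `k` is admissible, and these are patched by a partition of
unity. -/
theorem exists_norm_sub_comp_le {T K : Type*} [TopologicalSpace T] [CompactSpace T]
    [TopologicalSpace K] [CompactSpace K] [T2Space K] (r : C(T, K))
    (hr : Function.Surjective r) (f : C(T, ℝ)) {η : ℝ}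
    (h : ∀ s t, r s = r t → |f s - f t| < η) :
    ∃ g : C(K, ℝ), ∀ t, |f t - g (r t)| < η := by
  obtain ⟨g, hg⟩ := exists_continuous_forall_mem_convex_of_local_const
    (t := fun k => ⋂ t : {t // r t = k}, Metric.ball (f t) η)
    (fun k => convex_iInter fun t => convex_ball _ _) (fun k => by
      obtain ⟨s, rfl⟩ := hr k
      refine ⟨f s, ?_⟩
      have hO : IsOpen {t | |f s - f t| < η} :=
        isOpen_lt (by fun_prop) continuous_const
      have hcl : IsClosedMap r := r.continuous.isClosedMap
      have hcl' := hcl _ hO.isClosed_compl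
      filter_upwards [hcl'.isOpen_compl.mem_nhds (x := r s) (by
        rintro ⟨t, ht, hts⟩
        exact ht (h s t hts.symm))] with k hk
      refine mem_iInter.2 fun ⟨t, ht⟩ => ?_
      by_contra hcon
      exact hk ⟨t, fun hlt => hcon (by rwa [Metric.mem_ball, Real.dist_eq]), ht⟩)
  refine ⟨g, fun t => ?_⟩
  have := mem_iInter.1 (hg (r t)) ⟨t, rfl⟩
  rwa [Metric.mem_ball, dist_comm, Real.dist_eq] at this

/-- Composition with a continuous surjection of compact spaces, as a linear isometry. -/
noncomputable def compLinearIsometry {T K : Type*} [TopologicalSpace T] [CompactSpace T]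
    [TopologicalSpace K] [CompactSpace K] (r : C(T, K)) (hr : Function.Surjective r) :
    C(K, ℝ) →ₗᵢ[ℝ] C(T, ℝ) where
  toFun g := g.comp r
  map_add' _ _ := rfl
  map_smul' _ _ := rfl
  norm_map' g := by
    refine le_antisymm ((ContinuousMap.norm_le _ (norm_nonneg g)).2 fun t => g.norm_coe_le_norm _)
      ((ContinuousMap.norm_le _ (norm_nonneg _)).2 fun k => ?_)
    obtain ⟨t, rfl⟩ := hr k
    exact (g.comp r).norm_coe_le_norm t

/-! ### The approximation theorem -/

theorem corollary5p2 (X : Type u) [NormedAddCommGroup X] [NormedSpace ℝ X] [CompleteSpace X]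
    [SeparableSpace (StrongDual ℝ X)] :
    Nonempty (X →ₗᵢ[ℝ] C(CantorSet, ℝ)) ∧
    ∀ (i : X →ₗᵢ[ℝ] C(CantorSet, ℝ)) (ε : ℝ), 0 < ε →
      ∃ σ : Ordinal.{u}, szlenkIndex X (ε / 2) = (σ : WithTop Ordinal.{u}) ∧
        ∃ α : Ordinal.{u}, α.card ≤ Cardinal.aleph0 ∧ α < ω ^ (σ + ω) ∧
          ∃ Y : Submodule ℝ C(CantorSet, ℝ),
            Nonempty (Y ≃ₗᵢ[ℝ] C(Set.Icc (0 : Ordinal.{u}) α, ℝ)) ∧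
            ∀ x : X, ∃ y ∈ Y, ‖i x - y‖ ≤ ε * ‖x‖ := by
  have := separableSpace_of_separableSpace_strongDual X
  refine ⟨nonempty_linearIsometry_cantorSet X, fun i ε hε => ?_⟩
  have hε2 : 0 < ε / 2 := half_pos hε
  obtain ⟨σ, hσ, hσe⟩ := exists_szlenkIndex_eq (X := X) hε2
  refine ⟨σ, hσ, ?_⟩
  let φ : CantorSet → StrongDual ℝ X := fun t =>
    (ContinuousMap.evalCLM ℝ t).comp i.toContinuousLinearMap
  have hφx : ∀ t x, φ t x = i x t := fun t x => rfl
  have hφ1 : ∀ t, ‖φ t‖ ≤ 1 := fun t =>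
    (φ t).opNorm_le_bound zero_le_one fun x => by
      rw [one_mul, hφx, ← i.norm_map x]
      exact (i x).norm_coe_le_norm t
  have hφc : Continuous fun t => StrongDual.toWeakDual (φ t) :=
    WeakDual.continuous_of_continuous_eval fun x => (i x).continuous
  let dw : WeakDual ℝ X → WeakDual ℝ X → ℝ :=
    fun f g => ‖WeakDual.toStrongDual f - WeakDual.toStrongDual g‖
  let B := {f : WeakDual ℝ X | ‖WeakDual.toStrongDual f‖ ≤ 1}
  -- The sequence of derived sets of the dual ball, pulled back to the Cantor set.
  let S : Ordinal.{u} → Set CantorSet := fun β =>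
    (fun t => StrongDual.toWeakDual (φ t)) ⁻¹' fragIter dw (ε / 2) B β
  obtain ⟨δ, hδ, hδc, r, hr, hri, hrd⟩ := exists_hasOrdinalFibration (S := S)
    (d := fun s t => ‖φ s - φ t‖) (c := ε / 2)
    (fun β => (isClosed_fragIter (isClosed_weakDual_closedBall 1) β).preimage hφc)
    (fun γ β h => preimage_mono (fragIter_antitone h))
    (eq_univ_of_forall fun t => by
      change _ ∈ fragIter dw (ε / 2) B 0
      rw [fragIter_zero]
      exact hφ1 t)
    (fun β hβ => by simp only [S]; rw [fragIter_limit hβ, preimage_iInter])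
    (fun γ t ht => by
      change _ ∉ fragIter dw (ε / 2) B (γ + 1) at ht
      rw [fragIter_add_one] at ht
      by_cases htγ : t ∈ S γ
      · obtain ⟨U, hU, htU, hUd⟩ : ∃ U, IsOpen U ∧ StrongDual.toWeakDual (φ t) ∈ U ∧
            pdiam dw (U ∩ fragIter dw (ε / 2) B γ) < ENNReal.ofReal (ε / 2) := by
          by_contra! h
          exact ht ⟨htγ, h⟩
        exact ⟨_, hU.preimage hφc, htU, fun x hx y hy =>
          dist_le_of_pdiam_lt (d := dw) hε2.le hUd hx hy⟩
      · exact ⟨(S γ)ᶜ, ((isClosed_fragIter (isClosed_weakDual_closedBall 1) γ).preimage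
          hφc).isOpen_compl, htγ, fun x hx => absurd hx.2 hx.1⟩)
    σ Set.univ isClopen_univ (by
      simp only [S]
      rw [hσe, preimage_empty, inter_empty])
  -- `[0, δ)` is compact and nonempty, hence has a largest element.
  obtain ⟨α, hα⟩ : ∃ α, IsGreatest (Iio δ) α := by
    rw [← hri]
    exact (isCompact_univ.image_of_continuousOn hr).exists_isGreatest (univ_nonempty.image r)
  have hδα : Iio δ = Icc 0 α :=
    Subset.antisymm (fun a ha => ⟨zero_le, hα.2 ha⟩) fun a ha => ha.2.trans_lt hα.1
  have hrα : ∀ t, r t ∈ Icc 0 α := fun t => hδα ▸ hri ▸ mem_image_of_mem r (mem_univ t)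
  let R : C(CantorSet, Icc (0 : Ordinal.{u}) α) :=
    ⟨fun t => ⟨r t, hrα t⟩, (continuousOn_univ.1 hr).subtype_mk _⟩
  have hR : Function.Surjective R := by
    rintro ⟨a, ha⟩
    rw [← hδα, ← hri] at ha
    obtain ⟨t, -, rfl⟩ := ha
    exact ⟨t, rfl⟩
  refine ⟨α, ?_, ?_, LinearMap.range (compLinearIsometry R hR).toLinearMap,
    ⟨(compLinearIsometry R hR).equivRange.symm⟩, fun x => ?_⟩
  · have h1 : (Iio α).Countable := hδc.mono (Iio_subset_Iio hα.1.le)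
    rw [← Cardinal.le_aleph0_iff_set_countable, Cardinal.mk_Iio_ordinal] at h1
    exact Cardinal.lift_le_aleph0.1 h1
  · exact (hα.1.trans hδ).trans_le (opow_le_opow_right omega0_pos le_self_add)
  · rcases eq_or_ne x 0 with rfl | hx
    · exact ⟨0, Submodule.zero_mem _, by simp⟩
    have hxn : 0 < ‖x‖ := norm_pos_iff.2 hx
    obtain ⟨g, hg⟩ := exists_norm_sub_comp_le R hR (i x) (η := ε * ‖x‖) fun s t hst => by
      have h1 := (φ s - φ t).le_of_opNorm_le
        (hrd s (mem_univ s) t (mem_univ t) (congrArg Subtype.val hst)) x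
      rw [sub_apply, hφx, hφx, Real.norm_eq_abs] at h1
      exact h1.trans_lt (by gcongr; linarith)
    exact ⟨_, ⟨g, rfl⟩, (ContinuousMap.norm_le _ (by positivity)).2 fun t => (hg t).le⟩
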